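/- Let $\mathbb X\subset\mathbb R^m$ and $\mathbb Y\subset\mathbb R^n$ be Borel sets and let $\mathbb U\subset\mathbb R^k$ be nonempty. Let $\mathcal T(dx'|x,u)$ be a stochastic kernel from $\mathbb X\times\mathbb U$ to $\mathbb X$, let $O(dy|x)$ be a stochastic kernel from $\mathbb X$ to $\mathbb Y$ (the observation channel), let $c:\mathbb X\times\mathbb U\to\mathbb R$ be a Borel measurable cost, $\beta\in(0,1)$ a discount factor and $\mu$ a probability measure on $\mathbb X$. For a channel $Q$ from $\mathbb X$ to an observation space $\mathbb W$, an admissible policy is a sequence $\gamma=(\gamma_t)_{t\ge0}$ of measurable functions with $U_t=\gamma_t(Y_0,\dots,Y_t,U_0,\dots,U_{t-1})$. Under $\gamma$, the process $(X_t,Y_t,U_t)_{t\ge0}$ has the law determined by $(X_0,Y_0)\sim\mu(dx_0)Q(dy_0|x_0)$ and, given the past up to time $t-1$, $(X_t,Y_t)\sim\mathcal T(dx_t|X_{t-1},U_{t-1})\,Q(dy_t|x_t)$. Put $$J_\beta(\mu,Q,\gamma)=\sum_{t=0}^\infty\beta^tE_\mu^{Q,\gamma}[c(X_t,U_t)],\qquad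 J_\beta^*(\mu,Q)=\inf_\gamma J_\beta(\mu,Q,\gamma),$$ the infimum being over all admissible policies that use the observations of $Q$. A finite quantization of $\mathbb Y$ consists of a partition of $\mathbb Y$ into Borel bins $B_0,\dots,B_M$ and distinct representative points $y_0,\dots,y_M\in\mathbb Y$. It defines the quantized channel $\hat O$ from $\mathbb X$ to $\{y_0,\dots,y_M\}$ by $\hat O(y_i|x)=O(B_i|x)$. Its maximal bin diameter is $L_{\mathbb Y}=\max_i\sup_{y,y'\in B_i}|y-y'|\in[0,\infty]$. Assume that $O(dy|x)=g(x,y)\,\lambda(dy)$ for a probability measure $\lambda$ on $\mathbb Y$ and a density $g\ge0$ such that $g(x,\cdot)$ is continuous on $\mathbb Y$ for every $x\in\mathbb X$, and that $c$ is bounded, $\sup_{x,u}|c(x,u)|<\infty$. Then $$\lim_{L_{\mathbb Y}\to0}\bigl(J_\beta^*(\mu,\hat O)-J_\beta^*(\mu,O)\bigr)=0,$$ that is, for every $\varepsilon>0$ there is $\delta>0$ such that $|J_\beta^*(\mu,\hat O)-J_\beta^*(\mu,O)|<\varepsilon$ for every finite quantization of $\mathbb Y$ with $L_{\mathbb Y}<\delta$.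 (Quantizations with arbitrarily small $L_{\mathbb Y}$ exist exactly when $\mathbb Y$ is bounded, for instance compact.) -/

import Mathlib

open MeasureTheory ProbabilityTheory Filter Topology
open scoped ENNReal NNReal

namespace POMDP

section Control

variable {X Y U : Type*} [MeasurableSpace X] [MeasurableSpace Y] [MeasurableSpace U]

/-- An admissible policy for observations in `Y` and actions in `U`: at each time `t`, a measurable
function of the information `I_t = (y_0, …, y_t, u_0, …, u_{t-1})`. -/
structure Policy (Y U : Type*) [MeasurableSpace Y] [MeasurableSpace U] where
  act : (t : ℕ) → (Fin (t + 1) → Y) × (Fin t → U) → U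
  measurable_act : ∀ t, Measurable (act t)

/-- The information `I_{n+1}` available to the controller at time `n + 1`, given the past
`(x_i, y_i, u_i)_{i ≤ n}`, the new state (which is not used) and the new observation. -/
def info (n : ℕ) (p : ((Finset.Iic n → X × Y × U) × X) × Y) :
    (Fin (n + 2) → Y) × (Fin (n + 1) → U) :=
  (fun i => if hi : (i : ℕ) ≤ n then (p.1.1 ⟨i, Finset.mem_Iic.2 hi⟩).2.1 else p.2,
   fun i => (p.1.1 ⟨i, Finset.mem_Iic.2 (Nat.lt_succ_iff.1 i.isLt)⟩).2.2)

lemma measurable_info (n : ℕ) : Measurable (info (X := X) (Y := Y) (U := U) n) := by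
  refine Measurable.prodMk (measurable_pi_lambda _ fun i => ?_) (measurable_pi_lambda _ fun i => ?_)
  · by_cases hi : (i : ℕ) ≤ n
    · simp only [hi, dite_true]
      fun_prop
    · simp only [hi, dite_false]
      fun_prop
  · fun_prop

/-- The law of `(X_0, Y_0, U_0)`: `μ(dx_0) O(dy_0 | x_0)` and `u_0 = γ_0(y_0)`. -/
noncomputable def initLaw (μ : Measure X) (O : Kernel X Y) (γ : Policy Y U) :
    Measure (X × Y × U) :=
  μ ⊗ₘ (O ⊗ₖ Kernel.deterministic
    (fun p : X × Y => γ.act 0 (fun _ => p.2, Fin.elim0))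
    ((γ.measurable_act 0).comp (by fun_prop)))

/-- The conditional law of `(X_{n+1}, Y_{n+1}, U_{n+1})` given the past `(x_i, y_i, u_i)_{i ≤ n}`:
`T(dx_{n+1} | x_n, u_n) O(dy_{n+1} | x_{n+1})` and `u_{n+1} = γ_{n+1}(I_{n+1})`. -/
noncomputable def step (T : Kernel (X × U) X) (O : Kernel X Y) (γ : Policy Y U) (n : ℕ) :
    Kernel (Finset.Iic n → X × Y × U) (X × Y × U) :=
  (T.comap
    (fun h : Finset.Iic n → X × Y × U =>
      ((h ⟨n, Finset.mem_Iic.2 le_rfl⟩).1, (h ⟨n, Finset.mem_Iic.2 le_rfl⟩).2.2))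
    (by fun_prop)) ⊗ₖ
  ((O.comap (fun p : (Finset.Iic n → X × Y × U) × X => p.2) measurable_snd) ⊗ₖ
    Kernel.deterministic (fun p => γ.act (n + 1) (info n p))
      ((γ.measurable_act (n + 1)).comp (measurable_info n)))

instance (T : Kernel (X × U) X) [IsMarkovKernel T] (O : Kernel X Y) [IsMarkovKernel O]
    (γ : Policy Y U) (n : ℕ) : IsMarkovKernel (step T O γ n) := by
  unfold step; infer_instance

/-- The law of the controlled process `(X_t, Y_t, U_t)_{t ≥ 0}`. -/
noncomputable def law (μ : Measure X) (T : Kernel (X × U) X) [IsMarkovKernel T]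
    (O : Kernel X Y) [IsMarkovKernel O] (γ : Policy Y U) : Measure (ℕ → X × Y × U) :=
  Kernel.trajMeasure (X := fun _ => X × Y × U) (initLaw μ O γ) (step T O γ)

/-- The discounted cost `J_β(μ, O, γ) = ∑ₜ βᵗ E[c(X_t, U_t)]`. -/
noncomputable def cost (β : ℝ) (c : X → U → ℝ) (T : Kernel (X × U) X) [IsMarkovKernel T]
    (μ : Measure X) (O : Kernel X Y) [IsMarkovKernel O] (γ : Policy Y U) : ℝ :=
  ∑' t : ℕ, β ^ t * ∫ ω, c (ω t).1 (ω t).2.2 ∂(law μ T O γ)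

/-- The optimal cost `J_β^*(μ, O)`, the infimum over all policies that use the observations of the
channel `O`. -/
noncomputable def optCost (β : ℝ) (c : X → U → ℝ) (T : Kernel (X × U) X) [IsMarkovKernel T]
    (μ : Measure X) (O : Kernel X Y) [IsMarkovKernel O] : ℝ :=
  ⨅ γ : Policy Y U, cost β c T μ O γ

end Control

section Quantization

variable {X Y : Type*} [MeasurableSpace X] [MeasurableSpace Y]

/-- A finite quantization of `Y`: a partition of `Y` into measurable bins `B_0, …, B_M`, with
distinct representative points `y_0, …, y_M`. -/
structure Quantizer (Y : Type*) [MeasurableSpace Y] where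
  M : ℕ
  bin : Fin (M + 1) → Set Y
  measurableSet_bin : ∀ i, MeasurableSet (bin i)
  disjoint_bin : Pairwise fun i j => Disjoint (bin i) (bin j)
  iUnion_bin : ⋃ i, bin i = Set.univ
  rep : Fin (M + 1) → Y
  rep_injective : Function.Injective rep

namespace Quantizer

/-- The finite set `{y_0, …, y_M}` of quantized observations. -/
abbrev Obs (Q : Quantizer Y) : Type _ := Set.range Q.rep

/-- The representative `y_i`, as a quantized observation. -/
def point (Q : Quantizer Y) (i : Fin (Q.M + 1)) : Q.Obs := ⟨Q.rep i, i, rfl⟩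

/-- The maximal diameter of the bins (infinite if some bin is unbounded). -/
noncomputable def maxDiam [PseudoEMetricSpace Y] (Q : Quantizer Y) : ℝ≥0∞ :=
  ⨆ i, Metric.ediam (Q.bin i)

/-- The quantized channel: the kernel to `{y_0, …, y_M}` that gives the point `y_i` the mass
`O(B_i | x)`. -/
noncomputable def channel (Q : Quantizer Y) (O : Kernel X Y) : Kernel X Q.Obs where
  toFun x := ∑ i, O x (Q.bin i) • Measure.dirac (Q.point i)
  measurable' := by
    refine Measure.measurable_of_measurable_coe _ fun s _ => ?_
    simp only [Measure.coe_finsetSum, Finset.sum_apply, Measure.smul_apply, smul_eq_mul]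
    exact Finset.measurable_sum _ fun i _ =>
      (O.measurable_coe (Q.measurableSet_bin i)).mul_const _

instance (Q : Quantizer Y) (O : Kernel X Y) [IsMarkovKernel O] :
    IsMarkovKernel (Q.channel O) := by
  refine ⟨fun x => ⟨?_⟩⟩
  change (∑ i, O x (Q.bin i) • Measure.dirac (Q.point i)) Set.univ = 1
  simp only [Measure.coe_finsetSum, Finset.sum_apply, Measure.smul_apply, smul_eq_mul,
    measure_univ, mul_one]
  rw [← tsum_fintype (L := .unconditional _),
    ← measure_iUnion Q.disjoint_bin Q.measurableSet_bin, Q.iUnion_bin, measure_univ]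

lemma channel_apply_point [MeasurableSingletonClass Y] (Q : Quantizer Y) (O : Kernel X Y) (x : X)
    (i : Fin (Q.M + 1)) : Q.channel O x {Q.point i} = O x (Q.bin i) := by
  change (∑ j, O x (Q.bin j) • Measure.dirac (Q.point j)) {Q.point i} = _
  simp only [Measure.coe_finsetSum, Finset.sum_apply, Measure.smul_apply, smul_eq_mul,
    Measure.dirac_apply' _ (measurableSet_singleton _)]
  rw [Finset.sum_eq_single i]
  · simp
  · intro j _ hj
    have : Q.point j ≠ Q.point i := fun h => hj (Q.rep_injective (congrArg Subtype.val h))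
    simp [this]
  · simp

end Quantizer

end Quantization

end POMDP

/-! One inequality holds for every quantization: a quantized observation is a function of the
original one, so a policy for `Ô` can be run on the observations of `O` at the same cost
(`value_map`). Hence `J*(O) ≤ J*(Ô)`.

For the converse up to `ε`, send each representative point back to `Y` by drawing a point of its bin
from `λ` conditioned on the bin. The composed channel from `X` to `Y` has as density the bin
averages of `g(x, ·)`. By continuity of `g(x, ·)` these averages converge `λ`-almost everywhere as
the bins shrink, and Scheffé's argument, applied for each `x` separately, gives convergence of
integrals even when the bounded integrands vary too (`tendsto_integral_randomize`). A fixed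
near-optimal policy `γ` for `O` can be run on all these channels, since they share the observation
space `Y`; `γ` need only be measurable. Its finite-horizon cost then converges to the one under `O`
by induction on the horizon (`tendsto_value`).

The composed channel is a garbling of `Ô`, and private randomization does not help: some policy for
`Ô` itself does at least as well over the given horizon (`exists_integral_value_le`). Discounting
makes the truncation error at most `β^N C / (1 - β)`, uniformly in policy and channel
(`abs_cost_sub_integral_value_le`).

The value is conditioned on the hidden state rather than on a belief, so no filter or regular
conditional law is needed. -/

namespace POMDP

/-! ### Information available to the controller -/

section Info

variable {X Y U : Type*}

/-- The observations and actions before time `n`. -/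
abbrev Info (Y U : Type*) (n : ℕ) : Type _ := (Fin n → Y) × (Fin n → U)

/-- The information before time `n + 1`, from the one before time `n`. -/
def Info.extend {n : ℕ} (i : Info Y U n) (y : Y) (u : U) : Info Y U (n + 1) :=
  (Fin.snoc i.1 y, Fin.snoc i.2 u)

/-- The observations and actions before time `n` along a trajectory. -/
def trajInfo (n : ℕ) (ω : ℕ → X × Y × U) : Info Y U n :=
  (fun i => (ω i).2.1, fun i => (ω i).2.2)

/-- The observations and actions up to time `n` along a finite trajectory. -/
def pastInfo (n : ℕ) (h : Finset.Iic n → X × Y × U) : Info Y U (n + 1) :=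
  (fun i => (h ⟨i, Finset.mem_Iic.2 (Nat.lt_succ_iff.1 i.isLt)⟩).2.1,
   fun i => (h ⟨i, Finset.mem_Iic.2 (Nat.lt_succ_iff.1 i.isLt)⟩).2.2)

lemma trajInfo_succ (n : ℕ) (ω : ℕ → X × Y × U) :
    trajInfo (n + 1) ω = (trajInfo n ω).extend (ω n).2.1 (ω n).2.2 := by
  refine Prod.ext ?_ ?_ <;>
  · ext i
    induction i using Fin.lastCases <;> simp [trajInfo, Info.extend]

lemma info_eq (n : ℕ) (h : Finset.Iic n → X × Y × U) (x : X) (y : Y) :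
    info n ((h, x), y) = (Fin.snoc (pastInfo n h).1 y, (pastInfo n h).2) := by
  refine Prod.ext ?_ rfl
  ext i
  induction i using Fin.lastCases with
  | last => simp [info]
  | cast i => simp [info, pastInfo, Nat.lt_succ_iff.1 i.isLt]

end Info

/-! ### Finite-horizon values by backward recursion -/

section Value

variable {X Y U : Type*} [MeasurableSpace X] [MeasurableSpace Y] [MeasurableSpace U]

lemma measurable_snoc {Z : Type*} [MeasurableSpace Z] (n : ℕ) :
    Measurable fun p : (Fin n → Z) × Z => (Fin.snoc p.1 p.2 : Fin (n + 1) → Z) := by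
  refine measurable_pi_lambda _ fun i => ?_
  induction i using Fin.lastCases with
  | last => simpa using measurable_snd
  | cast i => simp only [Fin.snoc_castSucc]; fun_prop

lemma measurable_extend (n : ℕ) :
    Measurable fun p : Info Y U n × Y × U => p.1.extend p.2.1 p.2.2 :=
  ((measurable_snoc n).comp (f := fun p : Info Y U n × Y × U => (p.1.1, p.2.1)) (by fun_prop)).prodMk
    ((measurable_snoc n).comp (f := fun p : Info Y U n × Y × U => (p.1.2, p.2.2)) (by fun_prop))

/-- The action that a policy takes at time `n`, given the past and the new observation. -/
def Policy.next (γ : Policy Y U) {n : ℕ} (i : Info Y U n) (y : Y) : U :=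
  γ.act n (Fin.snoc i.1 y, i.2)

lemma Policy.measurable_next (γ : Policy Y U) (n : ℕ) :
    Measurable fun p : Info Y U n × Y => γ.next p.1 p.2 :=
  (γ.measurable_act n).comp
    (((measurable_snoc n).comp (f := fun p : Info Y U n × Y => (p.1.1, p.2)) (by fun_prop)).prodMk
      (by fun_prop))

/-- The expected discounted cost of the `N` stages from time `n` on, given the observations and
actions before time `n` and the state at time `n`. -/
noncomputable def value (β : ℝ) (c : X → U → ℝ) (T : Kernel (X × U) X) (O : Kernel X Y)
    (γ : Policy Y U) : ℕ → (n : ℕ) → Info Y U n → X → ℝ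
  | 0, _, _, _ => 0
  | N + 1, n, i, x => ∫ y, (c x (γ.next i y) + β * ∫ x', value β c T O γ N (n + 1)
      (i.extend y (γ.next i y)) x' ∂T (x, γ.next i y)) ∂O x

variable {β : ℝ} {c : X → U → ℝ} {T : Kernel (X × U) X} {O : Kernel X Y}

lemma measurable_value_next [IsSFiniteKernel T] {γ : Policy Y U} {N n : ℕ}
    (h : Measurable fun p : Info Y U (n + 1) × X => value β c T O γ N (n + 1) p.1 p.2) :
    Measurable fun p : Info Y U n × X × Y × U =>
      ∫ x', value β c T O γ N (n + 1) (p.1.extend p.2.2.1 p.2.2.2) x' ∂T (p.2.1, p.2.2.2) := by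
  have := StronglyMeasurable.integral_kernel_prod_right
    (κ := T.comap (fun p : Info Y U n × X × Y × U => (p.2.1, p.2.2.2)) (by fun_prop))
    (f := fun p x' => value β c T O γ N (n + 1) (p.1.extend p.2.2.1 p.2.2.2) x')
    (h.comp (((measurable_extend n).comp
      (f := fun q : (Info Y U n × X × Y × U) × X => (q.1.1, q.1.2.2)) (by fun_prop)).prodMk
      measurable_snd)).stronglyMeasurable
  exact this.measurable

lemma measurable_stage [IsSFiniteKernel T] (hc : Measurable (Function.uncurry c))
    {γ : Policy Y U} {N n : ℕ}
    (h : Measurable fun p : Info Y U (n + 1) × X => value β c T O γ N (n + 1) p.1 p.2) :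
    Measurable fun p : Info Y U n × X × Y × U => c p.2.1 p.2.2.2 + β *
      ∫ x', value β c T O γ N (n + 1) (p.1.extend p.2.2.1 p.2.2.2) x' ∂T (p.2.1, p.2.2.2) :=
  (hc.comp (f := fun p : Info Y U n × X × Y × U => (p.2.1, p.2.2.2)) (by fun_prop)).add
    ((measurable_value_next h).const_mul β)

lemma measurable_value [IsSFiniteKernel T] [IsSFiniteKernel O]
    (hc : Measurable (Function.uncurry c)) (γ : Policy Y U) (N n : ℕ) :
    Measurable fun p : Info Y U n × X => value β c T O γ N n p.1 p.2 := by
  induction N generalizing n with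
  | zero => simpa only [value] using measurable_const
  | succ N ih =>
    have hn : Measurable fun q : (Info Y U n × X) × Y => γ.next q.1.1 q.2 :=
      (γ.measurable_next n).comp (f := fun q : (Info Y U n × X) × Y => (q.1.1, q.2)) (by fun_prop)
    have := StronglyMeasurable.integral_kernel_prod_right
      (κ := O.comap (fun p : Info Y U n × X => p.2) (by fun_prop))
      (f := fun p y => c p.2 (γ.next p.1 y) + β * ∫ x', value β c T O γ N (n + 1)
        (p.1.extend y (γ.next p.1 y)) x' ∂T (p.2, γ.next p.1 y))
      ((measurable_stage hc (ih (n + 1))).comp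
        (f := fun q : (Info Y U n × X) × Y => (q.1.1, q.1.2, q.2, γ.next q.1.1 q.2))
        (by fun_prop)).stronglyMeasurable
    exact this.measurable

/-- The cost of a stage plus the discounted value of the following ones, given the past and the
state, observation and action of the stage. -/
noncomputable def stage (β : ℝ) (c : X → U → ℝ) (T : Kernel (X × U) X) (O : Kernel X Y)
    (γ : Policy Y U) (N : ℕ) {n : ℕ} (i : Info Y U n) (x : X) (y : Y) (u : U) : ℝ :=
  c x u + β * ∫ x', value β c T O γ N (n + 1) (i.extend y u) x' ∂T (x, u)

lemma value_succ (γ : Policy Y U) (N : ℕ) {n : ℕ} (i : Info Y U n) (x : X) :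
    value β c T O γ (N + 1) n i x = ∫ y, stage β c T O γ N i x y (γ.next i y) ∂O x := rfl

lemma measurable_uncurry_stage [IsSFiniteKernel T] [IsSFiniteKernel O]
    (hc : Measurable (Function.uncurry c)) (γ : Policy Y U) (N n : ℕ) :
    Measurable fun p : Info Y U n × X × Y × U =>
      stage β c T O γ N p.1 p.2.1 p.2.2.1 p.2.2.2 :=
  measurable_stage hc (measurable_value hc γ N (n + 1))

lemma abs_integral_le_of_le {Ω : Type*} [MeasurableSpace Ω] (ν : Measure Ω)
    [IsProbabilityMeasure ν] {f : Ω → ℝ} {K : ℝ} (h : ∀ ω, |f ω| ≤ K) : |∫ ω, f ω ∂ν| ≤ K := by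
  simpa using norm_integral_le_of_norm_le_const (μ := ν) (f := f) (.of_forall h)

lemma abs_value_le [IsMarkovKernel T] [IsMarkovKernel O] {C : ℝ} (hC : 0 ≤ C)
    (hcb : ∀ x u, |c x u| ≤ C) (hβ : β ∈ Set.Ioo (0 : ℝ) 1) (γ : Policy Y U) (N n : ℕ)
    (i : Info Y U n) (x : X) : |value β c T O γ N n i x| ≤ C / (1 - β) := by
  have h1 : 0 < 1 - β := sub_pos.2 hβ.2
  induction N generalizing n x with
  | zero => simpa [value] using div_nonneg hC h1.le
  | succ N ih =>
    refine abs_integral_le_of_le _ fun y => ?_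
    -- The bound is the fixed point of `K ↦ C + β K`, so it propagates through the recursion with no
    -- dependence on `N`.
    have h2 : C + β * (C / (1 - β)) = C / (1 - β) := by field_simp; ring
    rw [← h2]
    refine (abs_add_le _ _).trans (add_le_add (hcb _ _) ?_)
    rw [abs_mul, abs_of_pos hβ.1]
    exact mul_le_mul_of_nonneg_left (abs_integral_le_of_le _ fun x' => ih _ _ x') hβ.1.le

lemma abs_stage_le [IsMarkovKernel T] [IsMarkovKernel O] {C : ℝ} (hC : 0 ≤ C)
    (hcb : ∀ x u, |c x u| ≤ C) (hβ : β ∈ Set.Ioo (0 : ℝ) 1) (γ : Policy Y U) (N : ℕ) {n : ℕ}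
    (i : Info Y U n) (x : X) (y : Y) (u : U) : |stage β c T O γ N i x y u| ≤ C / (1 - β) := by
  have h1 : 0 < 1 - β := sub_pos.2 hβ.2
  have h2 : C + β * (C / (1 - β)) = C / (1 - β) := by field_simp; ring
  rw [← h2]
  refine (abs_add_le _ _).trans (add_le_add (hcb _ _) ?_)
  rw [abs_mul, abs_of_pos hβ.1]
  exact mul_le_mul_of_nonneg_left
    (abs_integral_le_of_le _ fun x' => abs_value_le hC hcb hβ γ N _ _ x') hβ.1.le

lemma integrable_of_abs_le {Ω : Type*} [MeasurableSpace Ω] (ν : Measure Ω)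
    [IsFiniteMeasure ν] {f : Ω → ℝ} (hf : Measurable f) {K : ℝ} (h : ∀ ω, |f ω| ≤ K) :
    Integrable f ν :=
  .of_bound hf.aestronglyMeasurable K (.of_forall h)

end Value

/-! ### Values and the law of the controlled process -/

section Law

variable {X Y U : Type*} [MeasurableSpace X] [MeasurableSpace Y] [MeasurableSpace U]
  {β : ℝ} {c : X → U → ℝ} {T : Kernel (X × U) X} [IsMarkovKernel T] {O : Kernel X Y}
  [IsMarkovKernel O] {μ : Measure X}

lemma map_eval_zero_law (γ : Policy Y U) :
    (law μ T O γ).map (fun ω => ω 0) = initLaw μ O γ := by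
  have h0 : (fun ω : ℕ → X × Y × U => ω 0) =
      (MeasurableEquiv.piUnique (fun _ : Finset.Iic 0 => X × Y × U)) ∘
        Preorder.frestrictLe (π := fun _ => X × Y × U) 0 := rfl
  unfold law Kernel.trajMeasure
  rw [h0, ← Measure.map_map (by fun_prop) (by fun_prop), Measure.map_comp _ _ (by fun_prop),
    Kernel.traj_map_frestrictLe, Kernel.partialTraj_self, Measure.id_comp,
    Measure.map_map (by fun_prop) (by fun_prop)]
  convert Measure.map_id
  ext1 p
  exact (MeasurableEquiv.piUnique (fun _ : Finset.Iic 0 => X × Y × U)).apply_symm_apply p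

variable [IsProbabilityMeasure μ]

instance (γ : Policy Y U) : IsProbabilityMeasure (initLaw μ O γ) := by
  unfold initLaw; infer_instance

instance (γ : Policy Y U) : IsProbabilityMeasure (law μ T O γ) := by
  unfold law; infer_instance

lemma integral_initLaw (γ : Policy Y U) {f : X × Y × U → ℝ} (hf : Measurable f) {K : ℝ}
    (hK : ∀ p, |f p| ≤ K) :
    ∫ p, f p ∂initLaw μ O γ = ∫ x, ∫ y, f (x, y, γ.next (Fin.elim0, Fin.elim0) y) ∂O x ∂μ := by
  unfold initLaw
  rw [Measure.integral_compProd (integrable_of_abs_le _ hf hK)]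
  refine integral_congr_ae (.of_forall fun x => ?_)
  dsimp only
  rw [ProbabilityTheory.integral_compProd (integrable_of_abs_le _ (by fun_prop) fun _ => hK _)]
  refine integral_congr_ae (.of_forall fun y => ?_)
  dsimp only
  rw [Kernel.deterministic_apply, integral_dirac' (fun u => f (x, y, u)) _
    (hf.comp (f := fun u => (x, y, u)) (by fun_prop)).stronglyMeasurable]
  congr 4

lemma measurable_pastInfo (n : ℕ) : Measurable (pastInfo (X := X) (Y := Y) (U := U) n) := by
  unfold pastInfo; fun_prop

lemma integral_step (γ : Policy Y U) (n : ℕ) (h : Finset.Iic n → X × Y × U)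
    {f : X × Y × U → ℝ} (hf : Measurable f) {K : ℝ} (hK : ∀ p, |f p| ≤ K) :
    ∫ p, f p ∂step T O γ n h = ∫ x, ∫ y, f (x, y, γ.next (pastInfo n h) y) ∂O x
      ∂T ((h ⟨n, Finset.mem_Iic.2 le_rfl⟩).1, (h ⟨n, Finset.mem_Iic.2 le_rfl⟩).2.2) := by
  unfold step
  rw [ProbabilityTheory.integral_compProd (integrable_of_abs_le _ hf hK)]
  rw [Kernel.comap_apply]
  refine integral_congr_ae (.of_forall fun x => ?_)
  dsimp only
  rw [ProbabilityTheory.integral_compProd (integrable_of_abs_le _ (by fun_prop) fun _ => hK _)]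
  rw [Kernel.comap_apply]
  refine integral_congr_ae (.of_forall fun y => ?_)
  dsimp only
  rw [Kernel.deterministic_apply, integral_dirac' (fun u => f (x, y, u)) _
    (hf.comp (f := fun u => (x, y, u)) (by fun_prop)).stronglyMeasurable, info_eq]
  rfl

lemma map_law_compProd_step (γ : Policy Y U) (n : ℕ) :
    (law μ T O γ).map (Preorder.frestrictLe n) ⊗ₘ step T O γ n =
      (law μ T O γ).map fun ω => (Preorder.frestrictLe n ω, ω (n + 1)) :=
  Kernel.map_frestrictLe_trajMeasure_compProd_eq_map_trajMeasure (X := fun _ => X × Y × U)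

/-- Tower property at time `n`. The integrand may depend on the whole past, because continuation
values do. -/
lemma integral_law_succ (γ : Policy Y U) (n : ℕ)
    {f : (Finset.Iic n → X × Y × U) × (X × Y × U) → ℝ} (hf : Measurable f) {K : ℝ}
    (hK : ∀ p, |f p| ≤ K) :
    ∫ ω, f (Preorder.frestrictLe n ω, ω (n + 1)) ∂law μ T O γ =
      ∫ ω, ∫ z, f (Preorder.frestrictLe n ω, z) ∂step T O γ n (Preorder.frestrictLe n ω)
        ∂law μ T O γ := by
  have hm : Measurable fun ω : ℕ → X × Y × U =>
      (Preorder.frestrictLe (π := fun _ => X × Y × U) n ω, ω (n + 1)) := by fun_prop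
  have hp : IsProbabilityMeasure ((law μ T O γ).map
      (Preorder.frestrictLe (π := fun _ => X × Y × U) n)) :=
    Measure.isProbabilityMeasure_map (by fun_prop)
  rw [← integral_map (f := f) hm.aemeasurable hf.aestronglyMeasurable, ← map_law_compProd_step]
  rw [Measure.integral_compProd (integrable_of_abs_le _ hf hK), integral_map (by fun_prop)]
  exact (StronglyMeasurable.integral_kernel_prod_right (f := fun a b => f (a, b))
    hf.stronglyMeasurable).aestronglyMeasurable

/-- The costs of `N` stages after time `n`, in terms of the value at time `n + 1`. -/
lemma sum_integral_law_eq {C : ℝ} (hC : 0 ≤ C)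
    (hc : Measurable (Function.uncurry c)) (hcb : ∀ x u, |c x u| ≤ C)
    (hβ : β ∈ Set.Ioo (0 : ℝ) 1) (γ : Policy Y U) (N n : ℕ) :
    ∑ s ∈ Finset.range N, β ^ s * ∫ ω, c (ω (n + 1 + s)).1 (ω (n + 1 + s)).2.2 ∂law μ T O γ =
      ∫ ω, ∫ x, value β c T O γ N (n + 1) (trajInfo (n + 1) ω) x ∂T ((ω n).1, (ω n).2.2)
        ∂law μ T O γ := by
  induction N generalizing n with
  | zero => simp [value]
  | succ N ih =>
    have hstage := measurable_uncurry_stage (β := β) (T := T) (O := O) hc γ N (n + 1)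
    have hcm : Measurable fun ω : ℕ → X × Y × U => c (ω (n + 1)).1 (ω (n + 1)).2.2 :=
      hc.comp (f := fun ω : ℕ → X × Y × U => ((ω (n + 1)).1, (ω (n + 1)).2.2)) (by fun_prop)
    have key := integral_law_succ (μ := μ) (T := T) (O := O) γ n
      (f := fun q => stage β c T O γ N (pastInfo n q.1) q.2.1 q.2.2.1 q.2.2.2)
      (hstage.comp (((measurable_pastInfo n).comp measurable_fst).prodMk measurable_snd))
      (fun _ => abs_stage_le hC hcb hβ γ N _ _ _ _)
    have hr : ∀ ω : ℕ → X × Y × U, ∫ x, value β c T O γ (N + 1) (n + 1) (trajInfo (n + 1) ω) x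
        ∂T ((ω n).1, (ω n).2.2) = ∫ z, stage β c T O γ N (pastInfo n (Preorder.frestrictLe n ω))
          z.1 z.2.1 z.2.2 ∂step T O γ n (Preorder.frestrictLe n ω) := by
      intro ω
      rw [integral_step γ n _ (f := fun z => stage β c T O γ N
        (pastInfo n (Preorder.frestrictLe n ω)) z.1 z.2.1 z.2.2)
        (hstage.comp (f := fun z => (pastInfo n (Preorder.frestrictLe n ω), z)) (by fun_prop))
        (fun _ => abs_stage_le hC hcb hβ γ N _ _ _ _)]
      rfl
    simp_rw [hr]
    -- Split off the stage `s = 0`; the other stages, with one factor `β` taken out, are the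
    -- induction hypothesis at `n + 1`.
    rw [← key, Finset.sum_range_succ']
    have hsucc : ∀ ω : ℕ → X × Y × U, stage β c T O γ N (pastInfo n (Preorder.frestrictLe n ω))
        (ω (n + 1)).1 (ω (n + 1)).2.1 (ω (n + 1)).2.2 = c (ω (n + 1)).1 (ω (n + 1)).2.2 +
        β * ∫ x, value β c T O γ N (n + 1 + 1) (trajInfo (n + 1 + 1) ω) x
          ∂T ((ω (n + 1)).1, (ω (n + 1)).2.2) := by
      intro ω
      rw [trajInfo_succ (n + 1)]
      rfl
    have hv : Measurable fun ω : ℕ → X × Y × U => stage β c T O γ N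
        (pastInfo n (Preorder.frestrictLe n ω)) (ω (n + 1)).1 (ω (n + 1)).2.1 (ω (n + 1)).2.2 :=
      hstage.comp (f := fun ω : ℕ → X × Y × U =>
        (pastInfo n (Preorder.frestrictLe n ω), ω (n + 1)))
        (((measurable_pastInfo n).comp (by fun_prop)).prodMk (by fun_prop))
    have hi1 := integrable_of_abs_le (law μ T O γ) hv fun _ => abs_stage_le hC hcb hβ γ N _ _ _ _
    have hi2 := integrable_of_abs_le (law μ T O γ) hcm fun _ => hcb _ _
    have e1 : ∫ ω, stage β c T O γ N (pastInfo n (Preorder.frestrictLe n ω))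
        (ω (n + 1)).1 (ω (n + 1)).2.1 (ω (n + 1)).2.2 ∂law μ T O γ =
        ∫ ω, c (ω (n + 1)).1 (ω (n + 1)).2.2 ∂law μ T O γ +
        β * ∫ ω, ∫ x, value β c T O γ N (n + 1 + 1) (trajInfo (n + 1 + 1) ω) x
          ∂T ((ω (n + 1)).1, (ω (n + 1)).2.2) ∂law μ T O γ := by
      rw [← integral_const_mul, ← sub_eq_iff_eq_add', ← integral_sub hi1 hi2]
      refine integral_congr_ae (.of_forall fun ω => ?_)
      simp only [hsucc]
      ring
    rw [e1, ← ih (n + 1), Finset.mul_sum, add_comm]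
    simp only [pow_zero, one_mul, add_zero, pow_succ]
    congr 1
    refine Finset.sum_congr rfl fun s _ => ?_
    rw [show n + 1 + (s + 1) = n + 1 + 1 + s by ring]
    ring

lemma sum_integral_law_eq_integral_value {C : ℝ} (hC : 0 ≤ C)
    (hc : Measurable (Function.uncurry c)) (hcb : ∀ x u, |c x u| ≤ C)
    (hβ : β ∈ Set.Ioo (0 : ℝ) 1) (γ : Policy Y U) (N : ℕ) :
    ∑ t ∈ Finset.range N, β ^ t * ∫ ω, c (ω t).1 (ω t).2.2 ∂law μ T O γ =
      ∫ x, value β c T O γ N 0 (Fin.elim0, Fin.elim0) x ∂μ := by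
  -- Time `0` is treated apart: its law is `initLaw`, not `step`. The later stages come from
  -- `sum_integral_law_eq` at `n = 0`.
  rcases N with _ | N
  · simp [value]
  have hstage : Measurable fun p : X × Y × U =>
      stage β c T O γ N (Fin.elim0, Fin.elim0) p.1 p.2.1 p.2.2 :=
    (measurable_uncurry_stage hc γ N 0).comp (f := fun p => ((Fin.elim0, Fin.elim0), p))
      (by fun_prop)
  have hcm : Measurable fun ω : ℕ → X × Y × U => c (ω 0).1 (ω 0).2.2 :=
    hc.comp (f := fun ω : ℕ → X × Y × U => ((ω 0).1, (ω 0).2.2)) (by fun_prop)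
  have hb : ∀ p : X × Y × U, |stage β c T O γ N (Fin.elim0, Fin.elim0) p.1 p.2.1 p.2.2| ≤
      C / (1 - β) := fun p => abs_stage_le hC hcb hβ γ N _ _ _ _
  have hm : Measurable fun ω : ℕ → X × Y × U => ω 0 := by fun_prop
  simp_rw [value_succ]
  rw [← integral_initLaw γ hstage hb, ← map_eval_zero_law (T := T),
    integral_map hm.aemeasurable hstage.aestronglyMeasurable]
  have hi1 : Integrable (fun ω => stage β c T O γ N (Fin.elim0, Fin.elim0) (ω 0).1 (ω 0).2.1
      (ω 0).2.2) (law μ T O γ) := integrable_of_abs_le _ (hstage.comp hm) fun _ => hb _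
  have hi2 := integrable_of_abs_le (law μ T O γ) hcm fun _ => hcb _ _
  have e1 : ∫ ω, stage β c T O γ N (Fin.elim0, Fin.elim0) (ω 0).1 (ω 0).2.1 (ω 0).2.2
      ∂law μ T O γ = ∫ ω, c (ω 0).1 (ω 0).2.2 ∂law μ T O γ +
      β * ∫ ω, ∫ x, value β c T O γ N (0 + 1) (trajInfo (0 + 1) ω) x
        ∂T ((ω 0).1, (ω 0).2.2) ∂law μ T O γ := by
    rw [← integral_const_mul, ← sub_eq_iff_eq_add', ← integral_sub hi1 hi2]
    refine integral_congr_ae (.of_forall fun ω => ?_)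
    have h0 : trajInfo 0 ω = (Fin.elim0, Fin.elim0) :=
      Prod.ext (Subsingleton.elim _ _) (Subsingleton.elim _ _)
    simp only [trajInfo_succ, h0, stage]
    ring
  rw [e1, ← sum_integral_law_eq hC hc hcb hβ γ N 0, Finset.sum_range_succ', Finset.mul_sum,
    add_comm]
  simp only [pow_zero, one_mul, pow_succ]
  congr 1
  refine Finset.sum_congr rfl fun s _ => ?_
  rw [show 0 + 1 + s = s + 1 by ring]
  ring

/-- The value of `N` stages is the cost up to an error that is uniform in the policy. -/
lemma abs_cost_sub_integral_value_le {C : ℝ} (hC : 0 ≤ C)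
    (hc : Measurable (Function.uncurry c)) (hcb : ∀ x u, |c x u| ≤ C)
    (hβ : β ∈ Set.Ioo (0 : ℝ) 1) (γ : Policy Y U) (N : ℕ) :
    |cost β c T μ O γ - ∫ x, value β c T O γ N 0 (Fin.elim0, Fin.elim0) x ∂μ| ≤
      β ^ N * (C / (1 - β)) := by
  have hle : ∀ t, |β ^ t * ∫ ω, c (ω t).1 (ω t).2.2 ∂law μ T O γ| ≤ β ^ t * C := fun t => by
    rw [abs_mul, abs_of_pos (pow_pos hβ.1 t)]
    exact mul_le_mul_of_nonneg_left (abs_integral_le_of_le _ fun _ => hcb _ _)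
      (pow_pos hβ.1 t).le
  have hg : HasSum (fun t => β ^ t * C) ((1 - β)⁻¹ * C) :=
    (hasSum_geometric_of_lt_one hβ.1.le hβ.2).mul_right C
  have hs : Summable fun t => β ^ t * ∫ ω, c (ω t).1 (ω t).2.2 ∂law μ T O γ :=
    .of_norm_bounded hg.summable hle
  rw [← sum_integral_law_eq_integral_value hC hc hcb hβ γ N, cost,
    ← hs.sum_add_tsum_nat_add N, add_sub_cancel_left]
  have hgN : HasSum (fun t => β ^ (t + N) * C) (β ^ N * (C / (1 - β))) := by
    have := hg.mul_left (β ^ N)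
    simpa only [pow_add, mul_comm, mul_left_comm, mul_assoc, div_eq_mul_inv] using this
  exact tsum_of_norm_bounded (E := ℝ) hgN fun t => hle (t + N)

lemma abs_cost_le {C : ℝ} (hC : 0 ≤ C) (hc : Measurable (Function.uncurry c))
    (hcb : ∀ x u, |c x u| ≤ C) (hβ : β ∈ Set.Ioo (0 : ℝ) 1) (γ : Policy Y U) :
    |cost β c T μ O γ| ≤ C / (1 - β) := by
  simpa [value] using abs_cost_sub_integral_value_le (μ := μ) (T := T) (O := O) hC hc hcb hβ γ 0

end Law

/-! ### Transforming policies -/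

section Policies

variable {X Y Z U : Type*} [MeasurableSpace X] [MeasurableSpace Y] [MeasurableSpace Z]
  [MeasurableSpace U]

instance [Nonempty U] : Nonempty (Policy Y U) :=
  ⟨⟨fun _ _ => Classical.arbitrary U, fun _ => measurable_const⟩⟩

/-- The policy that applies `γ` to the observations transformed by `q`. -/
def Policy.comap (γ : Policy Z U) (q : Y → Z) (hq : Measurable q) : Policy Y U where
  act t p := γ.act t (fun i => q (p.1 i), p.2)
  measurable_act t := (γ.measurable_act t).comp (by fun_prop)

lemma Policy.comap_next (γ : Policy Z U) {q : Y → Z} (hq : Measurable q) {n : ℕ} (i : Info Y U n)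
    (y : Y) : (γ.comap q hq).next i y = γ.next (fun k => q (i.1 k), i.2) (q y) := by
  refine congrArg (γ.act n) (Prod.ext (funext fun k => ?_) rfl)
  induction k using Fin.lastCases <;> simp

/-- The policy that plays `u z` at time `n` when the observation is `z`, and follows `γ z` later. -/
def Policy.switch [Countable Z] [MeasurableSingletonClass Z] (n : ℕ) (u : Z → U)
    (γ : Z → Policy Z U) : Policy Z U where
  act t p := if t = n then u (p.1 (Fin.last t)) else
    -- For `t > n` this reads the observation of time `n`; for `t < n` the minimum only keeps the
    -- index in range.
    (γ (p.1 ⟨min n t, Nat.lt_succ_of_le (min_le_right n t)⟩)).act t p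
  measurable_act t := by
    by_cases h : t = n
    · simp only [h, if_true]
      exact (measurable_of_countable u).comp (by fun_prop)
    · simp only [h, if_false]
      -- Countability of `Z` is what makes the choice of policy by observation measurable.
      have : Measurable fun q : Z × ((Fin (t + 1) → Z) × (Fin t → U)) => (γ q.1).act t q.2 :=
        measurable_from_prod_countable_right fun z => (γ z).measurable_act t
      exact this.comp (f := fun p => (p.1 ⟨min n t, Nat.lt_succ_of_le (min_le_right n t)⟩, p))
        (by fun_prop)

lemma Policy.switch_next_self [Countable Z] [MeasurableSingletonClass Z] (n : ℕ) (u : Z → U)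
    (γ : Z → Policy Z U) (i : Info Z U n) (z : Z) : (Policy.switch n u γ).next i z = u z := by
  simp [Policy.next, Policy.switch]

lemma Policy.switch_next_of_lt [Countable Z] [MeasurableSingletonClass Z] {n m : ℕ} (hnm : n < m)
    (u : Z → U) (γ : Z → Policy Z U) (i : Info Z U m) (z : Z) :
    (Policy.switch n u γ).next i z = (γ (i.1 ⟨n, hnm⟩)).next i z := by
  have h : (⟨min n m, Nat.lt_succ_of_le (min_le_right n m)⟩ : Fin (m + 1)) =
      Fin.castSucc ⟨n, hnm⟩ := Fin.ext (min_eq_left hnm.le)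
  have h2 : (Fin.snoc i.1 z : Fin (m + 1) → Z) ⟨min n m, Nat.lt_succ_of_le (min_le_right n m)⟩ =
      i.1 ⟨n, hnm⟩ := by rw [h]; exact Fin.snoc_castSucc (α := fun _ => Z) z i.1 ⟨n, hnm⟩
  simp only [Policy.next, Policy.switch, hnm.ne', if_false, h2]

variable {β : ℝ} {c : X → U → ℝ} {T : Kernel (X × U) X}

/-- The value only depends on the decisions after the given past. -/
lemma value_congr {O : Kernel X Z} {γ γ' : Policy Z U} {p : ℕ} {z : Z}
    (h : ∀ (m : ℕ) (hm : p < m) (i : Info Z U m) (w : Z), i.1 ⟨p, hm⟩ = z →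
      γ.next i w = γ'.next i w) (N m : ℕ) (hm : p < m) (i : Info Z U m) (hi : i.1 ⟨p, hm⟩ = z)
    (x : X) : value β c T O γ N m i x = value β c T O γ' N m i x := by
  induction N generalizing m x with
  | zero => rfl
  | succ N ih =>
    simp only [value_succ, stage]
    refine integral_congr_ae (.of_forall fun w => ?_)
    have he : (i.extend w (γ'.next i w)).1 ⟨p, hm.trans (Nat.lt_succ_self m)⟩ = z := by
      rw [← hi]
      exact Fin.snoc_castSucc (α := fun _ => Z) w i.1 ⟨p, hm⟩
    simp only [h m hm i w hi, ih (m + 1) (hm.trans (Nat.lt_succ_self m)) _ he]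

/-- Change of variables at each stage: the actions see observations only through `q`, so the
recursions for `O` and for its image under `q` agree. -/
lemma value_map [IsSFiniteKernel T] {O : Kernel X Y} [IsSFiniteKernel O]
    (hc : Measurable (Function.uncurry c)) (γ : Policy Z U) {q : Y → Z} (hq : Measurable q)
    (N n : ℕ) (i : Info Y U n) (x : X) :
    value β c T O (γ.comap q hq) N n i x =
      value β c T (O.map q) γ N n (fun k => q (i.1 k), i.2) x := by
  induction N generalizing n x with
  | zero => rfl
  | succ N ih =>
    have hm : Measurable fun z => stage β c T (O.map q) γ N (fun k => q (i.1 k), i.2) x z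
        (γ.next (fun k => q (i.1 k), i.2) z) :=
      (measurable_uncurry_stage hc γ N n).comp (f := fun z =>
        ((fun k => q (i.1 k), i.2), x, z, γ.next (fun k => q (i.1 k), i.2) z))
        (by have := (γ.measurable_next n).comp
              (f := fun z => ((fun k => q (i.1 k), i.2), z)) (by fun_prop)
            exact measurable_const.prodMk (measurable_const.prodMk (measurable_id.prodMk this)))
    rw [value_succ, value_succ, Kernel.map_apply _ hq,
      integral_map hq.aemeasurable hm.aestronglyMeasurable]
    refine integral_congr_ae (.of_forall fun y => ?_)
    simp only [stage, Policy.comap_next, ih]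
    congr 3
    ext x'
    congr 1
    refine Prod.ext ?_ rfl
    ext k
    induction k using Fin.lastCases <;> simp [Info.extend]

end Policies

/-! ### Garbled observations do not help -/

section Garbling

variable {X Y Z U : Type*} [MeasurableSpace X] [MeasurableSpace Y] [MeasurableSpace Z]
  [MeasurableSpace U] {β : ℝ} {c : X → U → ℝ} {T : Kernel (X × U) X} [IsMarkovKernel T]

lemma integral_bind_kernel {A B : Type*} [MeasurableSpace A] [MeasurableSpace B] (ν : Measure A)
    [IsFiniteMeasure ν] (κ : Kernel A B) [IsFiniteKernel κ] {f : B → ℝ} (hf : Measurable f)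
    {K : ℝ} (hK : ∀ b, |f b| ≤ K) : ∫ b, f b ∂(κ ∘ₘ ν) = ∫ a, ∫ b, f b ∂κ a ∂ν := by
  rw [Measure.comp_eq_comp_const_apply, Kernel.integral_comp, Kernel.const_apply]
  exact integrable_of_abs_le _ hf hK

/-- With observation and action frozen, averaging over the state pushes `ν` through `T`. This
returns an integrated value at the next time, to which an induction over all finite measures
applies. -/
lemma integral_stage {C : ℝ} (hC : 0 ≤ C) (hc : Measurable (Function.uncurry c))
    (hcb : ∀ x u, |c x u| ≤ C) (hβ : β ∈ Set.Ioo (0 : ℝ) 1) (O : Kernel X Y) [IsMarkovKernel O]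
    (γ : Policy Y U) (N : ℕ) {n : ℕ} (i : Info Y U n) (y : Y) (u : U) (ν : Measure X)
    [IsFiniteMeasure ν] :
    ∫ x, stage β c T O γ N i x y u ∂ν = ∫ x, c x u ∂ν + β *
      ∫ x, value β c T O γ N (n + 1) (i.extend y u) x
        ∂((T.comap (fun x => (x, u)) (by fun_prop)) ∘ₘ ν) := by
  have hcm : Measurable fun x => c x u := hc.comp (f := fun x => (x, u)) (by fun_prop)
  have hvm : Measurable fun x => value β c T O γ N (n + 1) (i.extend y u) x :=
    (measurable_value hc γ N (n + 1)).comp (f := fun x => (i.extend y u, x)) (by fun_prop)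
  have hsm : Measurable fun x => stage β c T O γ N i x y u :=
    (measurable_uncurry_stage hc γ N n).comp (f := fun x => (i, x, y, u)) (by fun_prop)
  rw [integral_bind_kernel _ _ hvm fun x => abs_value_le hC hcb hβ γ N (n + 1) _ x,
    ← integral_const_mul, ← sub_eq_iff_eq_add', ← integral_sub
    (integrable_of_abs_le _ hsm fun x => abs_stage_le hC hcb hβ γ N _ _ _ _)
    (integrable_of_abs_le _ hcm fun x => hcb _ _)]
  refine integral_congr_ae (.of_forall fun x => ?_)
  simp [stage]

/-- The part of `ν` where the channel `O` sends the state to `z`. -/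
noncomputable def jointWith (ν : Measure X) (O : Kernel X Z) (z : Z) : Measure X :=
  ν.withDensity fun x => O x {z}

instance (ν : Measure X) [IsFiniteMeasure ν] (O : Kernel X Z) [IsMarkovKernel O] (z : Z) :
    IsFiniteMeasure (jointWith ν O z) := by
  refine isFiniteMeasure_withDensity (ne_top_of_le_ne_top (measure_ne_top ν Set.univ) ?_)
  simpa using lintegral_mono (μ := ν) fun x => prob_le_one (μ := O x) (s := {z})

/-- The pieces are left unnormalized, so observations of probability zero need no separate
treatment. -/
lemma integral_integral_eq_sum_jointWith [Fintype Z] [MeasurableSingletonClass Z] (ν : Measure X)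
    [IsFiniteMeasure ν] (O : Kernel X Z) [IsMarkovKernel O] {f : X → Z → ℝ}
    (hf : ∀ z, Measurable fun x => f x z) {K : ℝ} (hK : ∀ x z, |f x z| ≤ K) :
    ∫ x, ∫ z, f x z ∂O x ∂ν = ∑ z, ∫ x, f x z ∂jointWith ν O z := by
  have hz : ∀ z, ∫ x, f x z ∂jointWith ν O z = ∫ x, (O x).real {z} • f x z ∂ν := fun z =>
    integral_withDensity_eq_integral_toReal_smul (O.measurable_coe (measurableSet_singleton z))
      (.of_forall fun x => measure_lt_top _ _) _
  simp_rw [hz]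
  rw [← integral_finsetSum]
  · refine integral_congr_ae (.of_forall fun x => ?_)
    exact integral_fintype (integrable_of_abs_le _ (measurable_of_countable _) (hK x))
  · intro z _
    refine integrable_of_abs_le (K := K) _
      ((O.measurable_coe (measurableSet_singleton z)).ennreal_toReal.mul (hf z)) fun x => ?_
    rw [smul_eq_mul, abs_mul, abs_of_nonneg measureReal_nonneg]
    exact (mul_le_of_le_one_left (abs_nonneg _) measureReal_le_one).trans (hK x z)

/-- Randomizing a finite observation does not help: any policy for a garbling of a channel with
finitely many observations is outperformed by a policy for the channel itself. -/
lemma exists_integral_value_le [Nonempty U] [Fintype Z] [MeasurableSingletonClass Z] {C : ℝ}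
    (hC : 0 ≤ C) (hc : Measurable (Function.uncurry c)) (hcb : ∀ x u, |c x u| ≤ C)
    (hβ : β ∈ Set.Ioo (0 : ℝ) 1) (O : Kernel X Z) [IsMarkovKernel O] (κ : Kernel Z Y)
    [IsMarkovKernel κ] (γ : Policy Y U) (N n : ℕ) (i : Info Y U n) (j : Info Z U n)
    (ν : Measure X) [IsFiniteMeasure ν] :
    ∃ γ' : Policy Z U, ∫ x, value β c T O γ' N n j x ∂ν ≤
      ∫ x, value β c T (κ ∘ₖ O) γ N n i x ∂ν := by
  induction N generalizing n ν with
  | zero => exact ⟨Classical.arbitrary _, le_rfl⟩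
  | succ N ih =>
    set S : X → Y → ℝ := fun x y => stage β c T (κ ∘ₖ O) γ N i x y (γ.next i y)
    have hSm : Measurable (Function.uncurry S) := by
      have hn : Measurable fun p : X × Y => γ.next i p.2 :=
        (γ.measurable_next n).comp (f := fun p : X × Y => (i, p.2)) (by fun_prop)
      exact (measurable_uncurry_stage hc γ N n).comp
        (f := fun p : X × Y => (i, p.1, p.2, γ.next i p.2)) (by fun_prop)
    have hSb : ∀ x y, |S x y| ≤ C / (1 - β) := fun x y => abs_stage_le hC hcb hβ γ N _ _ _ _
    have hint : ∀ z, Integrable (Function.uncurry S) ((jointWith ν O z).prod (κ z)) := fun z =>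
      integrable_of_abs_le _ hSm fun p => hSb p.1 p.2
    -- Given `z`, the garbled observation is independent of the state, so Fubini puts the average
    -- over `κ z` outside.
    have hgarb : ∫ x, value β c T (κ ∘ₖ O) γ (N + 1) n i x ∂ν =
        ∑ z, ∫ y, ∫ x, S x y ∂jointWith ν O z ∂κ z := by
      have h1 : ∀ x, value β c T (κ ∘ₖ O) γ (N + 1) n i x = ∫ z, ∫ y, S x y ∂κ z ∂O x := fun x =>
        Kernel.integral_comp (integrable_of_abs_le _
          (hSm.comp (f := fun y => (x, y)) (by fun_prop)) (hSb x))
      simp_rw [h1]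
      rw [integral_integral_eq_sum_jointWith ν O
        (fun z => hSm.stronglyMeasurable.integral_prod_right.measurable)
        (fun x z => abs_integral_le_of_le _ (hSb x))]
      exact Finset.sum_congr rfl fun z _ => integral_integral_swap (hint z)
    -- Derandomization: for each `z`, some fixed `y z` costs no more than the average over `κ z`.
    choose y hy using fun z => exists_le_integral (hint z).integral_prod_right
    set u : Z → U := fun z => γ.next i (y z)
    -- The two pasts diverge: `γ` believes it saw `y z`, while the new policy saw `z`. Hence the
    -- unrelated `i` and `j` in the statement.
    choose γ' hγ' using fun z => ih (n + 1) (i.extend (y z) (u z)) (j.extend z (u z))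
      ((T.comap (fun x => (x, u z)) (by fun_prop)) ∘ₘ jointWith ν O z)
    refine ⟨Policy.switch n u γ', ?_⟩
    have hval : ∀ x, value β c T O (Policy.switch n u γ') (N + 1) n j x =
        ∫ z, stage β c T O (γ' z) N j x z (u z) ∂O x := by
      intro x
      rw [value_succ]
      refine integral_congr_ae (.of_forall fun z => ?_)
      simp only [Policy.switch_next_self, stage]
      congr 3
      ext x'
      refine value_congr (p := n) (z := z) (fun m hm i' w hi' => ?_) N (n + 1) (Nat.lt_succ_self n)
        _ ?_ x'
      · rw [Policy.switch_next_of_lt hm, hi']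
      · exact Fin.snoc_last (α := fun _ => Z) z j.1
    have hstage : ∀ z, Measurable fun x => stage β c T O (γ' z) N j x z (u z) := fun z =>
      (measurable_uncurry_stage hc (γ' z) N n).comp (f := fun x => (j, x, z, u z)) (by fun_prop)
    simp_rw [hval]
    rw [hgarb, integral_integral_eq_sum_jointWith ν O hstage
      (fun x z => abs_stage_le hC hcb hβ (γ' z) N _ _ _ _)]
    refine Finset.sum_le_sum fun z _ => le_trans ?_ (hy z)
    rw [integral_stage hC hc hcb hβ]
    change _ ≤ ∫ x, stage β c T (κ ∘ₖ O) γ N i x (y z) (u z) ∂jointWith ν O z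
    rw [integral_stage hC hc hcb hβ]
    exact add_le_add le_rfl (mul_le_mul_of_nonneg_left (hγ' z) hβ.1.le)

end Garbling

/-! ### Continuity of the value in the channel -/

section Convergence

/-- A form of Scheffé's lemma: if probability densities converge almost everywhere, then so do the
integrals of bounded functions that converge pointwise. -/
lemma tendsto_integral_mul_of_tendsto_density {Ω : Type*} [MeasurableSpace Ω] {ν : Measure Ω}
    {f : ℕ → Ω → ℝ} {f₀ : Ω → ℝ} (hf : ∀ k, Integrable (f k) ν) (hf₀ : Integrable f₀ ν)
    (hpos : ∀ k ω, 0 ≤ f k ω) (hpos₀ : ∀ ω, 0 ≤ f₀ ω)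
    (hint : ∀ k, ∫ ω, f k ω ∂ν = ∫ ω, f₀ ω ∂ν)
    (hlim : ∀ᵐ ω ∂ν, Tendsto (fun k => f k ω) atTop (𝓝 (f₀ ω)))
    {F : ℕ → Ω → ℝ} {F₀ : Ω → ℝ} (hF : ∀ k, Measurable (F k)) {K : ℝ}
    (hK : ∀ k ω, |F k ω| ≤ K) (hFlim : ∀ ω, Tendsto (fun k => F k ω) atTop (𝓝 (F₀ ω))) :
    Tendsto (fun k => ∫ ω, F k ω * f k ω ∂ν) atTop (𝓝 (∫ ω, F₀ ω * f₀ ω ∂ν)) := by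
  -- Scheffé's device: the minimum is dominated by `f₀`, whereas `f k` itself has no dominating
  -- function.
  have hmin : ∀ k, Integrable (fun ω => min (f k ω) (f₀ ω)) ν := fun k => (hf k).inf hf₀
  have hminlim : ∀ᵐ ω ∂ν, Tendsto (fun k => min (f k ω) (f₀ ω)) atTop (𝓝 (f₀ ω)) := by
    filter_upwards [hlim] with ω h
    simpa using h.min (tendsto_const_nhds (x := f₀ ω))
  have h1 : Tendsto (fun k => ∫ ω, F k ω * min (f k ω) (f₀ ω) ∂ν) atTop
      (𝓝 (∫ ω, F₀ ω * f₀ ω ∂ν)) := by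
    refine tendsto_integral_of_dominated_convergence (fun ω => K * f₀ ω)
      (fun k => (hF k).aestronglyMeasurable.mul (hmin k).aestronglyMeasurable)
      (hf₀.const_mul K) (fun k => .of_forall fun ω => ?_) ?_
    · rw [Real.norm_eq_abs, abs_mul, abs_of_nonneg (le_min (hpos k ω) (hpos₀ ω))]
      exact mul_le_mul (hK k ω) (min_le_right _ _) (le_min (hpos k ω) (hpos₀ ω))
        ((abs_nonneg _).trans (hK k ω))
    · filter_upwards [hminlim] with ω h using (hFlim ω).mul h
  have h2 : Tendsto (fun k => ∫ ω, min (f k ω) (f₀ ω) ∂ν) atTop (𝓝 (∫ ω, f₀ ω ∂ν)) := by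
    refine tendsto_integral_of_dominated_convergence f₀ (fun k => (hmin k).aestronglyMeasurable)
      hf₀ (fun k => .of_forall fun ω => ?_) hminlim
    rw [Real.norm_eq_abs, abs_of_nonneg (le_min (hpos k ω) (hpos₀ ω))]
    exact min_le_right _ _
  have hFi : ∀ {h : Ω → ℝ} (k : ℕ), Integrable h ν → Integrable (fun ω => F k ω * h ω) ν :=
    fun k hh => hh.bdd_mul (hF k).aestronglyMeasurable (.of_forall (hK k))
  -- The excess of `f k` over the minimum is nonnegative, and by equality of masses its integral is
  -- `∫ f₀ - ∫ min`, which tends to `0`.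
  have h3 : Tendsto (fun k => ∫ ω, F k ω * f k ω ∂ν - ∫ ω, F k ω * min (f k ω) (f₀ ω) ∂ν) atTop
      (𝓝 0) := by
    refine squeeze_zero_norm (a := fun k => K * (∫ ω, f₀ ω ∂ν - ∫ ω, min (f k ω) (f₀ ω) ∂ν))
      (fun k => ?_) ?_
    · rw [← integral_sub (hFi k (hf k)) (hFi k (hmin k)), ← hint k,
        ← integral_sub (hf k) (hmin k), ← integral_const_mul]
      refine norm_integral_le_of_norm_le (((hf k).sub (hmin k)).const_mul K)
        (.of_forall fun ω => ?_)
      have h0 : 0 ≤ f k ω - min (f k ω) (f₀ ω) := sub_nonneg.2 (min_le_left _ _)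
      rw [← mul_sub, Real.norm_eq_abs, abs_mul, abs_of_nonneg h0]
      exact mul_le_mul_of_nonneg_right (hK k ω) h0
    · simpa using (h2.const_sub (∫ ω, f₀ ω ∂ν)).const_mul K
  simpa using h3.add h1

variable {X Y U : Type*} [MeasurableSpace X] [MeasurableSpace Y] [MeasurableSpace U]
  {β : ℝ} {c : X → U → ℝ} {T : Kernel (X × U) X} [IsMarkovKernel T]

/-- The value is continuous in the channel, for the convergence of the integrals of uniformly
bounded and pointwise convergent functions. -/
lemma tendsto_value {C : ℝ} (hC : 0 ≤ C) (hc : Measurable (Function.uncurry c))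
    (hcb : ∀ x u, |c x u| ≤ C) (hβ : β ∈ Set.Ioo (0 : ℝ) 1) {O : ℕ → Kernel X Y}
    [∀ k, IsMarkovKernel (O k)] {O₀ : Kernel X Y} [IsMarkovKernel O₀]
    (hO : ∀ (x : X) (F : ℕ → Y → ℝ) (F₀ : Y → ℝ) (K : ℝ), (∀ k, Measurable (F k)) →
      (∀ k y, |F k y| ≤ K) → (∀ y, Tendsto (fun k => F k y) atTop (𝓝 (F₀ y))) →
      Tendsto (fun k => ∫ y, F k y ∂O k x) atTop (𝓝 (∫ y, F₀ y ∂O₀ x)))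
    (γ : Policy Y U) (N n : ℕ) (i : Info Y U n) (x : X) :
    Tendsto (fun k => value β c T (O k) γ N n i x) atTop (𝓝 (value β c T O₀ γ N n i x)) := by
  induction N generalizing n x with
  | zero => exact tendsto_const_nhds
  | succ N ih =>
    simp_rw [value_succ]
    -- The integrand contains the continuation value and so varies with `k` along with the channel;
    -- hence the sequences `F k` in `hO`.
    refine hO x _ _ (C / (1 - β)) (fun k => ?_) (fun k y => abs_stage_le hC hcb hβ γ N _ _ _ _)
      fun y => ?_
    · have hn : Measurable fun y => γ.next i y :=
        (γ.measurable_next n).comp (f := fun y => (i, y)) (by fun_prop)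
      exact (measurable_uncurry_stage hc γ N n).comp (f := fun y => (i, x, y, γ.next i y))
        (by fun_prop)
    · refine tendsto_const_nhds.add (Tendsto.const_mul β ?_)
      refine tendsto_integral_of_dominated_convergence (fun _ => C / (1 - β)) (fun k => ?_)
        (integrable_const _)
        (fun k => .of_forall fun x' => abs_value_le hC hcb hβ γ N _ _ x')
        (.of_forall fun x' => ih (n + 1) _ x')
      exact ((measurable_value hc γ N (n + 1)).comp
        (f := fun x' => (i.extend y (γ.next i y), x')) (by fun_prop)).aestronglyMeasurable

end Convergence

/-! ### Quantization as a map, and its randomized inverse -/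

namespace Quantizer

section

variable {X Y : Type*} [MeasurableSpace X] [MeasurableSpace Y]

lemma exists_mem_bin (Q : Quantizer Y) (y : Y) : ∃ i, y ∈ Q.bin i :=
  Set.mem_iUnion.1 (Q.iUnion_bin ▸ Set.mem_univ y)

/-- The index of the bin of a point. -/
noncomputable def index (Q : Quantizer Y) (y : Y) : Fin (Q.M + 1) := (Q.exists_mem_bin y).choose

lemma mem_bin_index (Q : Quantizer Y) (y : Y) : y ∈ Q.bin (Q.index y) :=
  (Q.exists_mem_bin y).choose_spec

lemma index_eq_iff (Q : Quantizer Y) {y : Y} {i : Fin (Q.M + 1)} : Q.index y = i ↔ y ∈ Q.bin i := by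
  refine ⟨fun h => h ▸ Q.mem_bin_index y, fun h => ?_⟩
  by_contra hne
  exact Set.disjoint_left.1 (Q.disjoint_bin hne) (Q.mem_bin_index y) h

lemma measurable_index (Q : Quantizer Y) : Measurable Q.index := by
  refine measurable_to_countable' fun i => ?_
  convert Q.measurableSet_bin i
  ext y
  exact Q.index_eq_iff

lemma point_injective (Q : Quantizer Y) : Function.Injective Q.point :=
  fun _ _ h => Q.rep_injective (congrArg Subtype.val h)

lemma point_surjective (Q : Quantizer Y) : Function.Surjective Q.point :=
  fun ⟨_, i, hi⟩ => ⟨i, Subtype.ext hi⟩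

/-- The index of a representative point. -/
noncomputable def indexOf (Q : Quantizer Y) (z : Q.Obs) : Fin (Q.M + 1) :=
  (Q.point_surjective z).choose

lemma indexOf_point (Q : Quantizer Y) (i : Fin (Q.M + 1)) : Q.indexOf (Q.point i) = i :=
  Q.point_injective (Q.point_surjective (Q.point i)).choose_spec

/-- The representative of the bin of a point. -/
noncomputable def quantize (Q : Quantizer Y) (y : Y) : Q.Obs := Q.point (Q.index y)

lemma measurable_quantize (Q : Quantizer Y) : Measurable Q.quantize :=
  (measurable_of_countable Q.point).comp Q.measurable_index

lemma channel_eq_map [MeasurableSingletonClass Y] (Q : Quantizer Y) (O : Kernel X Y) :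
    Q.channel O = O.map Q.quantize := by
  ext1 x
  refine Measure.ext_of_singleton fun z => ?_
  obtain ⟨i, rfl⟩ := Q.point_surjective z
  rw [channel_apply_point, Kernel.map_apply' _ Q.measurable_quantize _ (measurableSet_singleton _)]
  congr 1
  ext y
  simp [quantize, Q.point_injective.eq_iff, Q.index_eq_iff]

/-- The kernel that picks a point in the bin of an observation, according to `lam`. -/
noncomputable def randomize [MeasurableSingletonClass Y] (Q : Quantizer Y) (lam : Measure Y) :
    Kernel Q.Obs Y :=
  open Classical in
  Kernel.ofFunOfCountable fun z =>
    -- On a null bin any probability measure would do; `lam` only keeps the kernel Markov.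
    if lam (Q.bin (Q.indexOf z)) = 0 then lam else lam[|Q.bin (Q.indexOf z)]

instance [MeasurableSingletonClass Y] (Q : Quantizer Y) (lam : Measure Y)
    [IsProbabilityMeasure lam] : IsMarkovKernel (Q.randomize lam) := by
  refine ⟨fun z => ?_⟩
  by_cases h : lam (Q.bin (Q.indexOf z)) = 0
  · simpa [randomize, Kernel.ofFunOfCountable, h]
  · simpa [randomize, Kernel.ofFunOfCountable, h] using cond_isProbabilityMeasure h

lemma randomize_point [MeasurableSingletonClass Y] (Q : Quantizer Y) (lam : Measure Y)
    {i : Fin (Q.M + 1)} (h : lam (Q.bin i) ≠ 0) : Q.randomize lam (Q.point i) = lam[|Q.bin i] := by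
  simp [randomize, Kernel.ofFunOfCountable, indexOf_point, h]

/-- The density of the channel that replaces an observation by a random point in its bin. -/
noncomputable def density (Q : Quantizer Y) (lam ν : Measure Y) (y : Y) : ℝ≥0∞ :=
  ν (Q.bin (Q.index y)) / lam (Q.bin (Q.index y))

lemma measurable_density (Q : Quantizer Y) (lam ν : Measure Y) :
    Measurable (Q.density lam ν) :=
  (measurable_of_countable fun i => ν (Q.bin i) / lam (Q.bin i)).comp Q.measurable_index

/-- On each bin the composition spreads the mass `O x (Q.bin i)` proportionally to `lam`, so its
density is constant there. -/
lemma randomize_comp_channel [MeasurableSingletonClass Y] (Q : Quantizer Y) (O : Kernel X Y)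
    (lam : Measure Y) [IsProbabilityMeasure lam] (x : X) (hac : O x ≪ lam) :
    (Q.randomize lam ∘ₖ Q.channel O) x = lam.withDensity (Q.density lam (O x)) := by
  ext s hs
  rw [Kernel.comp_apply' _ _ _ hs, withDensity_apply _ hs]
  have h1 : ∫⁻ z, Q.randomize lam z s ∂Q.channel O x =
      ∑ i, O x (Q.bin i) * Q.randomize lam (Q.point i) s := by
    change ∫⁻ z, Q.randomize lam z s ∂(∑ i, O x (Q.bin i) • Measure.dirac (Q.point i)) = _
    rw [lintegral_finsetSum_measure]
    refine Finset.sum_congr rfl fun i _ => ?_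
    rw [lintegral_smul_measure, lintegral_dirac, smul_eq_mul]
  have h2 : s = ⋃ i, s ∩ Q.bin i := by rw [← Set.inter_iUnion, Q.iUnion_bin, Set.inter_univ]
  rw [h1]
  conv_rhs => rw [h2]
  rw [lintegral_iUnion (fun i => hs.inter (Q.measurableSet_bin i))
    (fun i j hij => (Q.disjoint_bin hij).mono Set.inter_subset_right Set.inter_subset_right),
    tsum_fintype]
  refine Finset.sum_congr rfl fun i _ => ?_
  have h3 : ∫⁻ y in s ∩ Q.bin i, Q.density lam (O x) y ∂lam =
      O x (Q.bin i) / lam (Q.bin i) * lam (s ∩ Q.bin i) := by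
    rw [← setLIntegral_const]
    refine setLIntegral_congr_fun (hs.inter (Q.measurableSet_bin i)) fun y hy => ?_
    simp only [density, Q.index_eq_iff.2 hy.2]
  rw [h3]
  -- By absolute continuity `O x` does not charge a null bin either, so both sides vanish and the
  -- default in `randomize` is harmless.
  by_cases h0 : lam (Q.bin i) = 0
  · simp [hac h0]
  · rw [Q.randomize_point lam h0, cond_apply (Q.measurableSet_bin i), Set.inter_comm,
      div_eq_mul_inv, mul_assoc]

end

/-! ### Convergence of bin averages of the density -/

section

variable {X Y : Type*} [MeasurableSpace X] [MeasurableSpace Y] [PseudoEMetricSpace Y]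

/-- The density of the randomized quantized channel is close to a continuous density of the
channel. -/
lemma tendsto_density {lam ν : Measure Y} [IsProbabilityMeasure lam] {g : Y → ℝ≥0}
    (hg : Continuous g) (hgm : Measurable g) (hν : ν = lam.withDensity fun y => (g y : ℝ≥0∞))
    {Q : ℕ → Quantizer Y} (hQ : Tendsto (fun k => (Q k).maxDiam) atTop (𝓝 0)) :
    ∀ᵐ y ∂lam, Tendsto (fun k => (Q k).density lam ν y) atTop (𝓝 (g y : ℝ≥0∞)) := by
  -- The null bins of all the quantizers are countably many, so almost every point avoids them and
  -- its averages are genuine quotients.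
  have hnull : ∀ᵐ y ∂lam, ∀ k, lam ((Q k).bin ((Q k).index y)) ≠ 0 := by
    refine ae_all_iff.2 fun k => ?_
    have : ∀ᵐ y ∂lam, ∀ i, lam ((Q k).bin i) = 0 → y ∉ (Q k).bin i :=
      ae_all_iff.2 fun i => by
        by_cases h : lam ((Q k).bin i) = 0
        · filter_upwards [measure_eq_zero_iff_ae_notMem.1 h] with y hy _ using hy
        · exact .of_forall fun y h' => absurd h' h
    filter_upwards [this] with y hy h
    exact hy _ h ((Q k).mem_bin_index y)
  filter_upwards [hnull] with y hy
  refine (ENNReal.tendsto_nhds ENNReal.coe_ne_top).2 fun ε hε => ?_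
  have hcont : Tendsto (fun y' => (g y' : ℝ≥0∞)) (𝓝 y) (𝓝 (g y)) :=
    (ENNReal.continuous_coe.comp hg).continuousAt
  obtain ⟨δ, hδ, hball⟩ := EMetric.mem_nhds_iff.1
    ((ENNReal.tendsto_nhds ENNReal.coe_ne_top).1 hcont ε hε)
  filter_upwards [hQ.eventually (gt_mem_nhds hδ)] with k hk
  set B := (Q k).bin ((Q k).index y)
  have hBm : MeasurableSet B := (Q k).measurableSet_bin _
  -- The bin contains `y` and has diameter below `δ`, so `g` oscillates by at most `ε` around `g y`
  -- on it, and so does its average.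
  have hBg : ∀ y' ∈ B, (g y' : ℝ≥0∞) ∈ Set.Icc ((g y : ℝ≥0∞) - ε) (g y + ε) := fun y' hy' =>
    hball (((Metric.edist_le_ediam_of_mem hy' ((Q k).mem_bin_index y)).trans
      (le_iSup (fun i => Metric.ediam ((Q k).bin i)) _)).trans_lt hk)
  have hνB : ν B = ∫⁻ y' in B, g y' ∂lam := by rw [hν, withDensity_apply _ hBm]
  have hdiv : (Q k).density lam ν y = ν B / lam B := rfl
  rw [hdiv]
  constructor
  · rw [ENNReal.le_div_iff_mul_le (.inl (hy k)) (.inl (measure_ne_top _ _)), hνB,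
      ← setLIntegral_const]
    exact setLIntegral_mono hgm.coe_nnreal_ennreal fun y' hy' => (hBg y' hy').1
  · refine ENNReal.div_le_of_le_mul ?_
    rw [hνB, ← setLIntegral_const]
    exact setLIntegral_mono measurable_const fun y' hy' => (hBg y' hy').2

lemma tendsto_integral_randomize [MeasurableSingletonClass Y] {lam : Measure Y}
    [IsProbabilityMeasure lam] {O : Kernel X Y} [IsMarkovKernel O] {x : X} {g : Y → ℝ≥0}
    (hg : Continuous g) (hgm : Measurable g) (hO : O x = lam.withDensity fun y => (g y : ℝ≥0∞))
    {Q : ℕ → Quantizer Y} (hQ : Tendsto (fun k => (Q k).maxDiam) atTop (𝓝 0))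
    {F : ℕ → Y → ℝ} {F₀ : Y → ℝ} {K : ℝ} (hF : ∀ k, Measurable (F k))
    (hK : ∀ k y, |F k y| ≤ K) (hlim : ∀ y, Tendsto (fun k => F k y) atTop (𝓝 (F₀ y))) :
    Tendsto (fun k => ∫ y, F k y ∂((Q k).randomize lam ∘ₖ (Q k).channel O) x) atTop
      (𝓝 (∫ y, F₀ y ∂O x)) := by
  have hac : O x ≪ lam := hO ▸ withDensity_absolutelyContinuous _ _
  have hd : ∀ k, ((Q k).randomize lam ∘ₖ (Q k).channel O) x =
      lam.withDensity ((Q k).density lam (O x)) := fun k => (Q k).randomize_comp_channel O lam x hac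
  have hmass : ∀ k, ∫⁻ y, (Q k).density lam (O x) y ∂lam = 1 := fun k => by
    rw [← setLIntegral_univ, ← withDensity_apply _ .univ, ← hd k, measure_univ]
  have hmass₀ : ∫⁻ y, (g y : ℝ≥0∞) ∂lam = 1 := by
    rw [← setLIntegral_univ, ← withDensity_apply _ .univ, ← hO, measure_univ]
  have hfin : ∀ k, ∀ᵐ y ∂lam, (Q k).density lam (O x) y < ∞ := fun k =>
    ae_lt_top ((Q k).measurable_density lam (O x)) (by simp [hmass k])
  have hi : ∀ k, Integrable (fun y => ((Q k).density lam (O x) y).toReal) lam := fun k =>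
    integrable_toReal_of_lintegral_ne_top ((Q k).measurable_density lam (O x)).aemeasurable
      (by simp [hmass k])
  have hi₀ : Integrable (fun y => (g y : ℝ≥0∞).toReal) lam :=
    integrable_toReal_of_lintegral_ne_top hgm.coe_nnreal_ennreal.aemeasurable (by simp [hmass₀])
  have key := tendsto_integral_mul_of_tendsto_density (ν := lam) hi hi₀
    (fun _ _ => ENNReal.toReal_nonneg) (fun _ => ENNReal.toReal_nonneg)
    (fun k => by
      rw [integral_toReal ((Q k).measurable_density lam (O x)).aemeasurable (hfin k),
        integral_toReal hgm.coe_nnreal_ennreal.aemeasurable (.of_forall fun _ => ENNReal.coe_lt_top),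
        hmass k, hmass₀])
    (by
      filter_upwards [tendsto_density hg hgm hO hQ] with y h
      exact (ENNReal.tendsto_toReal ENNReal.coe_ne_top).comp h) hF hK hlim
  have e₀ : ∫ y, F₀ y ∂O x = ∫ y, F₀ y * (g y : ℝ≥0∞).toReal ∂lam := by
    rw [hO, integral_withDensity_eq_integral_toReal_smul hgm.coe_nnreal_ennreal
      (.of_forall fun _ => ENNReal.coe_lt_top)]
    exact integral_congr_ae (.of_forall fun y => mul_comm _ _)
  rw [e₀]
  refine key.congr fun k => ?_
  rw [hd k, integral_withDensity_eq_integral_toReal_smul ((Q k).measurable_density lam (O x))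
    (hfin k)]
  exact integral_congr_ae (.of_forall fun y => mul_comm _ _)

end

end Quantizer

/-! ### Comparison of optimal costs -/

section OptimalCost

variable {X Y U : Type*} [MeasurableSpace X] [MeasurableSpace Y] [MeasurableSpace U]
  {β : ℝ} {c : X → U → ℝ} {T : Kernel (X × U) X} [IsMarkovKernel T] {μ : Measure X}
  [IsProbabilityMeasure μ]

lemma optCost_le_cost {C : ℝ} (hC : 0 ≤ C) (hc : Measurable (Function.uncurry c))
    (hcb : ∀ x u, |c x u| ≤ C) (hβ : β ∈ Set.Ioo (0 : ℝ) 1) (O : Kernel X Y) [IsMarkovKernel O]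
    (γ : Policy Y U) : optCost β c T μ O ≤ cost β c T μ O γ := by
  refine ciInf_le ⟨-(C / (1 - β)), ?_⟩ γ
  rintro _ ⟨γ', rfl⟩
  exact (abs_le.1 (abs_cost_le hC hc hcb hβ γ')).1

lemma optCost_le_optCost_channel [MeasurableSingletonClass Y] [Nonempty U] {C : ℝ} (hC : 0 ≤ C)
    (hc : Measurable (Function.uncurry c)) (hcb : ∀ x u, |c x u| ≤ C)
    (hβ : β ∈ Set.Ioo (0 : ℝ) 1) (O : Kernel X Y) [IsMarkovKernel O] (Q : Quantizer Y) :
    optCost β c T μ O ≤ optCost β c T μ (Q.channel O) := by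
  refine le_ciInf fun γ => ?_
  refine (optCost_le_cost hC hc hcb hβ O (γ.comap Q.quantize Q.measurable_quantize)).trans ?_
  have hlim : Tendsto (fun N => 2 * (β ^ N * (C / (1 - β)))) atTop (𝓝 0) := by
    simpa using ((tendsto_pow_atTop_nhds_zero_of_lt_one hβ.1.le hβ.2).mul_const
      (C / (1 - β))).const_mul 2
  -- The two `N`-stage values coincide, so the costs differ by at most two truncation errors, for
  -- every `N`.
  refine le_of_sub_nonpos (ge_of_tendsto' hlim fun N => ?_)
  have h1 := (abs_le.1 (abs_cost_sub_integral_value_le (μ := μ) (T := T) (O := O) hC hc hcb hβ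
    (γ.comap Q.quantize Q.measurable_quantize) N)).2
  have h2 := (abs_le.1 (abs_cost_sub_integral_value_le (μ := μ) (T := T) (O := Q.channel O)
    hC hc hcb hβ γ N)).1
  have h3 : ∫ x, value β c T O (γ.comap Q.quantize Q.measurable_quantize) N 0
      (Fin.elim0, Fin.elim0) x ∂μ =
      ∫ x, value β c T (Q.channel O) γ N 0 (Fin.elim0, Fin.elim0) x ∂μ := by
    refine integral_congr_ae (.of_forall fun x => ?_)
    simp only [value_map hc γ Q.measurable_quantize N 0, ← Q.channel_eq_map]
    congr 2
    exact Subsingleton.elim _ _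
  rw [h3] at h1
  linarith

lemma tendsto_optCost_channel [PseudoEMetricSpace Y] [OpensMeasurableSpace Y]
    [MeasurableSingletonClass Y] [Nonempty U] {C : ℝ} (hC : 0 ≤ C)
    (hc : Measurable (Function.uncurry c)) (hcb : ∀ x u, |c x u| ≤ C)
    (hβ : β ∈ Set.Ioo (0 : ℝ) 1) (O : Kernel X Y) [IsMarkovKernel O] (lam : Measure Y)
    [IsProbabilityMeasure lam] (g : X → Y → ℝ≥0) (hg : ∀ x, Continuous (g x))
    (hO : ∀ x, O x = lam.withDensity (fun y => (g x y : ℝ≥0∞)))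
    {Q : ℕ → Quantizer Y} (hQ : Tendsto (fun k => (Q k).maxDiam) atTop (𝓝 0)) :
    Tendsto (fun k => optCost β c T μ ((Q k).channel O) - optCost β c T μ O) atTop (𝓝 0) := by
  refine tendsto_order.2 ⟨fun a ha => .of_forall fun k => ha.trans_le
    (sub_nonneg.2 (optCost_le_optCost_channel hC hc hcb hβ O (Q k))), fun a ha => ?_⟩
  -- Four errors of `a / 4`: near-optimality of `γ`, truncation under each of the two channels, and
  -- convergence of the `N`-stage value.
  obtain ⟨γ, hγ⟩ := exists_lt_of_ciInf_lt (f := fun γ => cost β c T μ O γ)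
    (show optCost β c T μ O < optCost β c T μ O + a / 4 by linarith)
  have hlim : Tendsto (fun N => β ^ N * (C / (1 - β))) atTop (𝓝 0) := by
    simpa using (tendsto_pow_atTop_nhds_zero_of_lt_one hβ.1.le hβ.2).mul_const (C / (1 - β))
  obtain ⟨N, hN⟩ := (hlim.eventually (gt_mem_nhds (show (0 : ℝ) < a / 4 by linarith))).exists
  have hval : Tendsto (fun k => ∫ x, value β c T ((Q k).randomize lam ∘ₖ (Q k).channel O) γ N 0
      (Fin.elim0, Fin.elim0) x ∂μ) atTop
      (𝓝 (∫ x, value β c T O γ N 0 (Fin.elim0, Fin.elim0) x ∂μ)) := by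
    refine tendsto_integral_of_dominated_convergence (fun _ => C / (1 - β)) (fun k => ?_)
      (integrable_const _) (fun k => .of_forall fun x => abs_value_le hC hcb hβ γ N _ _ x)
      (.of_forall fun x => tendsto_value hC hc hcb hβ (fun x F F₀ K hF hK hl =>
        Quantizer.tendsto_integral_randomize (hg x) (hg x).measurable (hO x) hQ hF hK hl) γ N 0 _ x)
    exact ((measurable_value hc γ N 0).comp
      (f := fun x => ((Fin.elim0, Fin.elim0), x)) (by fun_prop)).aestronglyMeasurable
  filter_upwards [hval.eventually (gt_mem_nhds (lt_add_of_pos_right _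
    (show (0 : ℝ) < a / 4 by linarith)))] with k hk
  have := Fintype.ofFinite (Q k).Obs
  obtain ⟨γ', hγ'⟩ := exists_integral_value_le hC hc hcb hβ ((Q k).channel O)
    ((Q k).randomize lam) (T := T) γ N 0 (Fin.elim0, Fin.elim0) (Fin.elim0, Fin.elim0) μ
  have h1 := (abs_le.1 (abs_cost_sub_integral_value_le (μ := μ) (T := T) (O := O) hC hc hcb hβ
    γ N)).1
  have h2 := (abs_le.1 (abs_cost_sub_integral_value_le (μ := μ) (T := T) (O := (Q k).channel O)
    hC hc hcb hβ γ' N)).2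
  have h3 := optCost_le_cost (T := T) (μ := μ) hC hc hcb hβ ((Q k).channel O) γ'
  linarith

end OptimalCost

end POMDP

theorem mainTheorem8 {m n k : ℕ}
    (X : Set (EuclideanSpace ℝ (Fin m))) (hX : MeasurableSet X)
    (Y : Set (EuclideanSpace ℝ (Fin n))) (hY : MeasurableSet Y)
    (U : Set (EuclideanSpace ℝ (Fin k))) (hU : U.Nonempty)
    (T : Kernel (X × U) X) [IsMarkovKernel T]
    (O : Kernel X Y) [IsMarkovKernel O]
    (lam : Measure Y) [IsProbabilityMeasure lam]
    (g : X → Y → ℝ≥0) (hg : ∀ x, Continuous (g x))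
    (hO : ∀ x, O x = lam.withDensity (fun y => (g x y : ℝ≥0∞)))
    (c : X → U → ℝ) (hc : Measurable (Function.uncurry c))
    (hcb : ∃ C : ℝ, ∀ x u, |c x u| ≤ C)
    (β : ℝ) (hβ : β ∈ Set.Ioo (0 : ℝ) 1)
    (μ : Measure X) [IsProbabilityMeasure μ] :
    Tendsto
      (fun Q : POMDP.Quantizer Y =>
        POMDP.optCost β c T μ (Q.channel O) - POMDP.optCost β c T μ O)
      (comap POMDP.Quantizer.maxDiam (𝓝 0)) (𝓝 0) := by
  obtain ⟨C, hC⟩ := hcb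
  have : Nonempty U := hU.to_subtype
  -- The filter is countably generated, so sequences suffice, as dominated convergence and the
  -- almost everywhere arguments require.
  refine tendsto_of_seq_tendsto fun Q hQ => ?_
  exact POMDP.tendsto_optCost_channel (le_max_right C 0) hc
    (fun x u => (hC x u).trans (le_max_left C 0)) hβ O lam g hg hO 
    (tendsto_comap_iff (f := Q) (g := POMDP.Quantizer.maxDiam).1 hQ)
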